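/- Let $K\ge 2$ and $n\ge 1$ be integers and let $\alpha\in(0,1)$ satisfy $\alpha^2 n\ge 1$. Let $\mathcal P_K=\{p\in[0,1]^K:\sum_{k=1}^K p_k=1\}$ and, for $\gamma>0$, let $F_\gamma(p)=\sum_{k=1}^K p_k^\gamma$. The sensitive data $x_1,\dots,x_n$ are i.i.d. with $\mathbb P(x_i=k)=p_k$, $k\in\{1,\dots,K\}$. An $\alpha$-locally differentially private ($\alpha$-LDP) mechanism $Q=(Q_1,\dots,Q_n)$ (interaction allowed) releases successively $Z_1,\dots,Z_n$, with values in arbitrary measurable spaces, where $Z_i$ is drawn from a conditional distribution $Q_i(\cdot\mid x_i,Z_1,\dots,Z_{i-1})$ such that, for every $i$, \[ Q_i(A\mid x,z_1,\dots,z_{i-1})\le e^{\alpha}\,Q_i(A\mid x',z_1,\dots,z_{i-1}) \] for all measurable $A$, all $x,x'\in\{1,\dots,K\}$ and all $z_1,\dots,z_{i-1}$. An estimator $\hat F$ is a measurable real-valued function of $(Z_1,\dots,Z_n)$. Consider the minimax quadratic risk \[ \mathcal R_\gamma(K,n,\alpha)=\inf_{Q,\hat F}\ \sup_{p\in\mathcal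 P_K}\ \mathbb E_p\big[(\hat F-F_\gamma(p))^2\big], \] where the infimum is over all $\alpha$-LDP mechanisms $Q$ and all estimators $\hat F$. Then for every $\gamma\in(0,1)\cup(1,2)$ there is a constant $c_\gamma>0$, depending only on $\gamma$, such that for all such $K,n,\alpha$: 1) if $\gamma\in(0,1)$, \[ \mathcal R_\gamma(K,n,\alpha)\ \ge\ c_\gamma\,\min\left\{K^{2(1-\gamma)},\ \frac{K^{2-\gamma}}{\big(n(e^{2\alpha}-e^{-2\alpha})^2\big)^{\gamma}}\right\}; \] 2) if $\gamma\in(1,2)$, \[ \mathcal R_\gamma(K,n,\alpha)\ \ge\ c_\gamma\,\min\left\{\frac{1}{\big[(e^{2\alpha}-e^{-2\alpha})^2 n\big]^{2(\gamma-1)}},\ \frac{K^{2-\gamma}}{\big[(e^{2\alpha}-e^{-2\alpha})^2 n\big]^{\gamma}}\right\}. \] -/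

import Mathlib

open MeasureTheory ProbabilityTheory
open scoped ENNReal

universe u

namespace LDP

/-- The space of histories `(Z_0, …, Z_{i-1})`, as an iterated product (a point for `i = 0`). -/
def Hist (Z : ℕ → Type u) : ℕ → Type u
  | 0 => PUnit
  | i + 1 => Hist Z i × Z i

/-- The product `σ`-algebra on the space of histories. -/
instance instMeasurableSpaceHist (Z : ℕ → Type u) [m : ∀ i, MeasurableSpace (Z i)] :
    ∀ i, MeasurableSpace (Hist Z i)
  | 0 => (⊤ : MeasurableSpace PUnit)
  | i + 1 => (instMeasurableSpaceHist Z i).prod (m i)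

/-- A sequentially interactive `α`-locally differentially private mechanism for `n` individuals
with data in `Fin K`. Individual `i` (numbered from `0`) releases a random element of an arbitrary
measurable space `Z i`, drawn from `Q i (Z_0, …, Z_{i-1}, x_i)`. Only the rounds `i < n` matter:
those with `n ≤ i` do not enter the law of the released sample and are unconstrained. -/
structure Mechanism (K n : ℕ) (α : ℝ) where
  Z : ℕ → Type u
  [measZ : ∀ i, MeasurableSpace (Z i)]
  Q : ∀ i, Kernel (Hist Z i × Fin K) (Z i)
  [markov : ∀ i, IsMarkovKernel (Q i)]
  ldp : ∀ i < n, ∀ (h : Hist Z i) (x x' : Fin K) (A : Set (Z i)), MeasurableSet A →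
    Q i (h, x) A ≤ ENNReal.ofReal (Real.exp α) * Q i (h, x') A

attribute [instance] Mechanism.measZ Mechanism.markov

/-- The distribution on `Fin K` of one sensitive observation, `ℙ (x = k) = p k`. -/
noncomputable def dataLaw {K : ℕ} (p : Fin K → ℝ) : Measure (Fin K) :=
  ∑ k, ENNReal.ofReal (p k) • Measure.dirac k

/-- The law of `(Z_0, …, Z_{i-1})` when the sensitive data are i.i.d. with distribution `p`:
given the history, `x_i` is drawn from `p` independently of it, then `Z_i` is drawn from
`Q i (history, x_i)`, and `x_i` is forgotten. -/
noncomputable def Mechanism.law {K n : ℕ} {α : ℝ} (M : Mechanism.{u} K n α) (p : Fin K → ℝ) :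
    ∀ i, Measure (Hist M.Z i)
  | 0 => Measure.dirac PUnit.unit
  | i + 1 => (((M.law p i).prod (dataLaw p)).compProd (M.Q i)).map
      (fun w : (Hist M.Z i × Fin K) × M.Z i => ((w.1.1, w.2) : Hist M.Z i × M.Z i))

/-- The power sum functional `F_γ(p) = ∑ k, p_k ^ γ`. -/
noncomputable def powerSum {K : ℕ} (γ : ℝ) (p : Fin K → ℝ) : ℝ := ∑ k, p k ^ γ

/-- An estimator is a measurable real function of the released sample `(Z_0, …, Z_{n-1})`. -/
def Mechanism.Estimator {K n : ℕ} {α : ℝ} (M : Mechanism.{u} K n α) : Type u :=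
  {F : Hist M.Z n → ℝ // Measurable F}

/-- The quadratic risk `𝔼_p (F̂ - F_γ(p))²`, with values in `[0, ∞]`. -/
noncomputable def Mechanism.risk {K n : ℕ} {α : ℝ} (M : Mechanism.{u} K n α) (F : M.Estimator)
    (γ : ℝ) (p : Fin K → ℝ) : ℝ≥0∞ :=
  ∫⁻ z, ENNReal.ofReal ((F.1 z - powerSum γ p) ^ 2) ∂(M.law p n)

/-- The minimax quadratic risk: infimum over all `α`-LDP mechanisms and all estimators of the
supremum of the risk over all probability vectors of size `K`. -/
noncomputable def minimaxRisk (γ : ℝ) (K n : ℕ) (α : ℝ) : ℝ≥0∞ :=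
  ⨅ (M : Mechanism.{u} K n α) (F : M.Estimator), ⨆ p ∈ stdSimplex ℝ (Fin K), M.risk F γ p

/-- The privacy factor `(e^{2α} - e^{-2α})²`. -/
noncomputable def privacyFactor (α : ℝ) : ℝ := (Real.exp (2 * α) - Real.exp (-2 * α)) ^ 2

end LDP

/-!
Fix a probability vector `p₀`, a finite family of perturbations `p ω`, and a mechanism. Given the
history, the laws of `Z_i` for the different values of `x_i` have densities in `[e^{-α}, e^α]` with
respect to their `p₀`-mixture. The conditional likelihood ratio of `Z_i` under `p ω` and under `p₀`
is therefore `1 + ∑ x, (p ω x - p₀ x) * a x` for some `a` bounded by `e^α - 1`. If such sums have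
mean square at most `(e^α - 1)² v` over `ω`, the chain rule bounds the mean over `ω` of the
Kullback-Leibler divergence of the released samples by `n e^α (e^α - 1)² v`. When this is at most
`1/2`, some `p ω` cannot be told from `p₀` (Le Cam's two-point bound). Taking the law under `p₀` as
reference makes the argument indifferent to interaction, because only `p₀` generates the histories.

Put `N = n (e^{2α} - e^{-2α})²`. The perturbations act on about `L` cells of mass `δ`, grouped in
pairs, and move the mass of each pair to one of its two cells. By the orthogonality of random signs
`v` is of order `L δ²`, whereas `F_γ` changes by order `L δ^γ`. With fewer than three cells
available, `(1, 0)` is compared with `(1 - δ, δ)` instead. The choice `δ⁻² = 4 L max(L, N)` gives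
the lower bound `L^(2 - γ) / max(L, N)^γ`; the first bound is the case `L = K`, the second the case
`L = min(K, N)`.
-/

namespace LDP

open InformationTheory

section Divergence

variable {E : Type*} [MeasurableSpace E]

lemma exists_density_of_le_smul (μ ν : Measure E) [IsFiniteMeasure μ] [IsFiniteMeasure ν] {C : ℝ}
    (hC : 1 ≤ C) (h₁ : μ ≤ ENNReal.ofReal C • ν) (h₂ : ν ≤ ENNReal.ofReal C • μ) :
    ∃ g : E → ℝ, Measurable g ∧ (∀ z, g z ∈ Set.Icc C⁻¹ C) ∧
      μ = ν.withDensity (fun z => ENNReal.ofReal (g z)) := by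
  have hC0 : 0 < C := by linarith
  have hμ := Measure.withDensity_rnDeriv_eq μ ν (Measure.absolutelyContinuous_of_le_smul h₁)
  have hmeas := Measure.measurable_rnDeriv μ ν
  have hup : μ.rnDeriv ν ≤ᵐ[ν] fun _ => ENNReal.ofReal C := by
    refine ae_le_of_forall_setLIntegral_le_of_sigmaFinite hmeas fun s hs _ => ?_
    rw [← withDensity_apply _ hs, hμ, setLIntegral_const]
    exact h₁ s
  have hlow : (fun _ => ENNReal.ofReal C⁻¹) ≤ᵐ[ν] μ.rnDeriv ν := by
    refine ae_le_of_forall_setLIntegral_le_of_sigmaFinite measurable_const fun s hs _ => ?_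
    rw [← withDensity_apply (μ.rnDeriv ν) hs, hμ, setLIntegral_const,
      ENNReal.ofReal_inv_of_pos hC0, mul_comm, ← div_eq_mul_inv]
    exact ENNReal.div_le_of_le_mul' (h₂ s)
  have hCi : C⁻¹ ≤ C := (inv_le_one_of_one_le₀ hC).trans hC
  refine ⟨fun z => max C⁻¹ (min C (μ.rnDeriv ν z).toReal), by fun_prop,
    fun z => ⟨le_max_left _ _, max_le hCi (min_le_left _ _)⟩, hμ.symm.trans ?_⟩
  refine withDensity_congr_ae ?_
  filter_upwards [hup, hlow] with z hz₁ hz₂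
  have hfin : μ.rnDeriv ν z ≠ ∞ := ne_top_of_le_ne_top ENNReal.ofReal_ne_top hz₁
  have h1 : (μ.rnDeriv ν z).toReal ≤ C := ENNReal.toReal_le_of_le_ofReal hC0.le hz₁
  have h2 : C⁻¹ ≤ (μ.rnDeriv ν z).toReal := (ENNReal.ofReal_le_iff_le_toReal hfin).1 hz₂
  rw [min_eq_right h1, max_eq_right h2, ENNReal.ofReal_toReal hfin]

lemma mul_klFun_inv_le {r : ℝ} (hr : 0 < r) : r * klFun r⁻¹ ≤ (r - 1) ^ 2 / r := by
  have hlog : 1 - r⁻¹ ≤ Real.log r := Real.one_sub_inv_le_log_of_pos hr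
  calc r * klFun r⁻¹ = r - 1 - Real.log r := by
        rw [klFun_apply, Real.log_inv]; field_simp; ring
    _ ≤ r - 1 - (1 - r⁻¹) := by gcongr
    _ = (r - 1) ^ 2 / r := by field_simp

lemma klDiv_withDensity_le_lintegral (μ : Measure E) [IsFiniteMeasure μ] {r : E → ℝ}
    (hr : Measurable r) (hr0 : ∀ z, 0 < r z)
    [IsFiniteMeasure (μ.withDensity fun z => ENNReal.ofReal (r z))] :
    klDiv μ (μ.withDensity fun z => ENNReal.ofReal (r z))
      ≤ ∫⁻ z, ENNReal.ofReal ((r z - 1) ^ 2 / r z) ∂μ := by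
  have hne : ∀ z, ENNReal.ofReal (r z) ≠ 0 := fun z => by simpa using hr0 z
  have hrn : μ.rnDeriv (μ.withDensity fun z => ENNReal.ofReal (r z))
      =ᵐ[μ] fun z => ENNReal.ofReal (r z)⁻¹ := by
    filter_upwards [Measure.rnDeriv_withDensity_right μ μ hr.ennreal_ofReal.aemeasurable
      (ae_of_all _ hne) (ae_of_all _ fun _ => ENNReal.ofReal_ne_top), Measure.rnDeriv_self μ]
      with z h1 h2
    rw [h1, h2, mul_one, ENNReal.ofReal_inv_of_pos (hr0 z)]
  rw [klDiv_eq_lintegral_klFun_of_ac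
      (withDensity_absolutelyContinuous' hr.ennreal_ofReal.aemeasurable (ae_of_all _ hne)),
    lintegral_withDensity_eq_lintegral_mul _ hr.ennreal_ofReal
      (by fun_prop (disch := exact measurable_klFun))]
  refine lintegral_mono_ae ?_
  filter_upwards [hrn] with z hz
  rw [Pi.mul_apply, hz, ENNReal.toReal_ofReal (inv_pos.2 (hr0 z)).le,
    ← ENNReal.ofReal_mul (hr0 z).le]
  exact ENNReal.ofReal_le_ofReal (mul_klFun_inv_le (hr0 z))

lemma mul_log_add_one_sub_le_klFun {s t : ℝ} (hs : 0 < s) (ht : 0 ≤ t) :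
    t * Real.log s + 1 - s ≤ klFun t := by
  rw [klFun_apply]
  rcases ht.eq_or_lt with rfl | ht
  · simp [hs.le]
  · have h := Real.log_le_sub_one_of_pos (div_pos hs ht)
    rw [Real.log_div hs.ne' ht.ne'] at h
    have h' := mul_le_mul_of_nonneg_left h ht.le
    rw [mul_sub, mul_sub, mul_div_cancel₀ _ ht.ne'] at h'
    linarith

lemma one_add_div_two_le_two_mul_min_add_klFun {t : ℝ} (ht : 0 ≤ t) :
    (1 + t) / 2 ≤ 2 * min 1 t + klFun t := by
  rcases le_total t 1 with h | h
  · have htan := mul_log_add_one_sub_le_klFun (s := 1 / 2) (by norm_num) ht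
    rw [one_div, Real.log_inv] at htan
    rw [min_eq_right h]
    nlinarith [Real.log_two_lt_d9]
  · have htan := mul_log_add_one_sub_le_klFun (s := 2) two_pos ht
    rw [min_eq_left h]
    nlinarith [Real.log_two_gt_d9]

lemma one_le_two_mul_lintegral_min_add_klDiv (μ ν : Measure E) [IsProbabilityMeasure μ]
    [IsProbabilityMeasure ν] :
    1 ≤ 2 * (∫⁻ z, min 1 (μ.rnDeriv ν z) ∂ν) + klDiv μ ν := by
  by_cases hμν : μ ≪ ν
  swap
  · simp [klDiv_of_not_ac hμν]
  rw [klDiv_eq_lintegral_klFun_of_ac hμν, ← lintegral_const_mul _ (by fun_prop),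
    ← lintegral_add_left (by fun_prop)]
  calc (1 : ℝ≥0∞) = ∫⁻ z, (1 + μ.rnDeriv ν z) / 2 ∂ν := by
        simp_rw [div_eq_mul_inv]
        rw [lintegral_mul_const _ (by fun_prop), lintegral_add_left measurable_const,
          Measure.lintegral_rnDeriv hμν, lintegral_const]
        simp only [measure_univ, mul_one, one_add_one_eq_two]
        rw [ENNReal.mul_inv_cancel two_ne_zero ENNReal.ofNat_ne_top]
    _ ≤ _ := by
        refine lintegral_mono_ae ?_
        filter_upwards [Measure.rnDeriv_lt_top μ ν] with z hz
        lift μ.rnDeriv ν z to NNReal using hz.ne with t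
        calc (1 + (t : ℝ≥0∞)) / 2 = ENNReal.ofReal ((1 + (t : ℝ)) / 2) := by
              rw [ENNReal.ofReal_div_of_pos two_pos, ENNReal.ofReal_add zero_le_one t.coe_nonneg,
                ENNReal.ofReal_one, ENNReal.ofReal_coe_nnreal, ENNReal.ofReal_ofNat]
          _ ≤ ENNReal.ofReal (2 * min 1 (t : ℝ) + klFun t) := ENNReal.ofReal_le_ofReal
              (one_add_div_two_le_two_mul_min_add_klFun t.coe_nonneg)
          _ = 2 * min 1 (t : ℝ≥0∞) + ENNReal.ofReal (klFun t) := by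
              rw [ENNReal.ofReal_add (by positivity) (klFun_nonneg t.coe_nonneg),
                ENNReal.ofReal_mul zero_le_two, ENNReal.ofReal_min, ENNReal.ofReal_one,
                ENNReal.ofReal_coe_nnreal, ENNReal.ofReal_ofNat]

lemma ofReal_sq_sub_div_two_mul_min_le (x a b : ℝ) (t : ℝ≥0∞) :
    ENNReal.ofReal ((a - b) ^ 2 / 2) * min 1 t
      ≤ t * ENNReal.ofReal ((x - a) ^ 2) + ENNReal.ofReal ((x - b) ^ 2) := by
  have hsq : (a - b) ^ 2 / 2 ≤ (x - a) ^ 2 + (x - b) ^ 2 := by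
    linarith [sq_nonneg ((x - a) + (x - b))]
  calc ENNReal.ofReal ((a - b) ^ 2 / 2) * min 1 t
      ≤ (ENNReal.ofReal ((x - a) ^ 2) + ENNReal.ofReal ((x - b) ^ 2)) * min 1 t := by
        rw [← ENNReal.ofReal_add (sq_nonneg _) (sq_nonneg _)]
        gcongr
    _ ≤ ENNReal.ofReal ((x - a) ^ 2) * t + ENNReal.ofReal ((x - b) ^ 2) * 1 := by
        rw [add_mul]
        gcongr
        exacts [min_le_right _ _, min_le_left _ _]
    _ = _ := by rw [mul_comm, mul_one]

lemma ofReal_sq_sub_div_eight_le_lintegral_add {μ ν : Measure E} [IsProbabilityMeasure μ]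
    [IsProbabilityMeasure ν] (h : klDiv μ ν ≤ 2⁻¹) {f : E → ℝ} (hf : Measurable f) (a b : ℝ) :
    ENNReal.ofReal ((a - b) ^ 2 / 8)
      ≤ ∫⁻ z, ENNReal.ofReal ((f z - a) ^ 2) ∂μ + ∫⁻ z, ENNReal.ofReal ((f z - b) ^ 2) ∂ν := by
  have hac : μ ≪ ν := not_imp_comm.1 klDiv_of_not_ac (h.trans_lt (by simp)).ne
  have haff : 2⁻¹ ≤ 2 * ∫⁻ z, min 1 (μ.rnDeriv ν z) ∂ν := by
    rw [← ENNReal.one_sub_inv_two, tsub_le_iff_right]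
    exact (one_le_two_mul_lintegral_min_add_klDiv μ ν).trans (by gcongr)
  rw [← lintegral_rnDeriv_mul hac (by fun_prop), ← lintegral_add_left (by fun_prop)]
  calc ENNReal.ofReal ((a - b) ^ 2 / 8)
      = ENNReal.ofReal ((a - b) ^ 2 / 4) * 2⁻¹ := by
        rw [← ENNReal.ofReal_ofNat 2, ← ENNReal.ofReal_inv_of_pos two_pos,
          ← ENNReal.ofReal_mul (by positivity)]
        ring_nf
    _ ≤ ENNReal.ofReal ((a - b) ^ 2 / 4) * (2 * ∫⁻ z, min 1 (μ.rnDeriv ν z) ∂ν) := by gcongr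
    _ = ENNReal.ofReal ((a - b) ^ 2 / 2) * ∫⁻ z, min 1 (μ.rnDeriv ν z) ∂ν := by
        rw [← mul_assoc, ← ENNReal.ofReal_ofNat 2, ← ENNReal.ofReal_mul (by positivity)]
        ring_nf
    _ = ∫⁻ z, ENNReal.ofReal ((a - b) ^ 2 / 2) * min 1 (μ.rnDeriv ν z) ∂ν :=
        (lintegral_const_mul _ (by fun_prop)).symm
    _ ≤ _ := lintegral_mono fun z => ofReal_sq_sub_div_two_mul_min_le (f z) a b _

end Divergence

section Mixture

variable {X E : Type*} [Fintype X] [MeasurableSpace E] {μ : X → Measure E} {p : X → ℝ}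

/-- The mixture of the measures `μ x` with weights `p x`; negative weights count as `0`. -/
noncomputable def mixture (p : X → ℝ) (μ : X → Measure E) : Measure E :=
  ∑ x, ENNReal.ofReal (p x) • μ x

lemma sum_ofReal_eq_one (hp : p ∈ stdSimplex ℝ X) : ∑ x, ENNReal.ofReal (p x) = 1 := by
  rw [← ENNReal.ofReal_sum_of_nonneg fun x _ => hp.1 x, hp.2, ENNReal.ofReal_one]

lemma sum_ofReal_smul_eq_self (hp : p ∈ stdSimplex ℝ X) (ν : Measure E) :
    ∑ x, ENNReal.ofReal (p x) • ν = ν := by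
  rw [← Finset.sum_smul, sum_ofReal_eq_one hp, one_smul]

lemma isProbabilityMeasure_mixture [∀ x, IsProbabilityMeasure (μ x)] (hp : p ∈ stdSimplex ℝ X) :
    IsProbabilityMeasure (mixture p μ) :=
  ⟨by simp [mixture, sum_ofReal_eq_one hp]⟩

lemma le_smul_mixture (hp : p ∈ stdSimplex ℝ X) {ν : Measure E} {c : ℝ≥0∞}
    (h : ∀ x, ν ≤ c • μ x) : ν ≤ c • mixture p μ := by
  rw [mixture, Finset.smul_sum, ← sum_ofReal_smul_eq_self hp ν]
  refine Finset.sum_le_sum fun x _ => ?_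
  rw [smul_comm c]
  gcongr
  exact h x

lemma mixture_le (hp : p ∈ stdSimplex ℝ X) {ν : Measure E} (h : ∀ x, μ x ≤ ν) :
    mixture p μ ≤ ν := by
  rw [← sum_ofReal_smul_eq_self hp ν]
  exact Finset.sum_le_sum fun x _ => by gcongr; exact h x

lemma mixture_withDensity (hp : ∀ x, 0 ≤ p x) (ν : Measure E) {g : X → E → ℝ}
    (hg : ∀ x, Measurable (g x)) (hg0 : ∀ x z, 0 ≤ g x z) :
    mixture p (fun x => ν.withDensity fun z => ENNReal.ofReal (g x z))
      = ν.withDensity fun z => ENNReal.ofReal (∑ x, p x * g x z) := by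
  ext s hs
  simp only [mixture, Measure.finsetSum_apply, Measure.smul_apply, withDensity_apply _ hs,
    smul_eq_mul]
  simp_rw [ENNReal.ofReal_sum_of_nonneg fun x _ => mul_nonneg (hp x) (hg0 x _),
    ENNReal.ofReal_mul (hp _)]
  rw [lintegral_finsetSum _ fun x _ => by fun_prop]
  exact Finset.sum_congr rfl fun x _ => (lintegral_const_mul _ (by fun_prop)).symm

lemma exists_mixture_density [∀ x, IsProbabilityMeasure (μ x)] (hp : p ∈ stdSimplex ℝ X) {C : ℝ}
    (hC : 1 ≤ C) (hμ : ∀ x x', μ x ≤ ENNReal.ofReal C • μ x') :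
    ∃ g : X → E → ℝ, (∀ x, Measurable (g x)) ∧ (∀ x z, g x z ∈ Set.Icc C⁻¹ C) ∧
      ∀ q : X → ℝ, (∀ x, 0 ≤ q x) →
        mixture q μ = (mixture p μ).withDensity fun z => ENNReal.ofReal (∑ x, q x * g x z) := by
  have := isProbabilityMeasure_mixture (μ := μ) hp
  choose g hg hgC hgμ using fun x => exists_density_of_le_smul (μ x) (mixture p μ) hC
    (le_smul_mixture hp (hμ x)) (mixture_le hp fun x' => hμ x' x)
  have hg0 : ∀ x z, 0 ≤ g x z := fun x z => (by positivity : 0 ≤ C⁻¹).trans (hgC x z).1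
  refine ⟨g, hg, hgC, fun q hq => ?_⟩
  rw [← mixture_withDensity hq _ hg hg0, ← funext hgμ]

/-- The signed weights `p ω - p₀`, tested against a function bounded by `B`, have mean square at
most `B ^ 2 * v`, the mean being over a uniform choice of the index `ω`. -/
def MeanSquareVariationLE {Ω : Type*} [Fintype Ω] (p₀ : X → ℝ) (p : Ω → X → ℝ) (v : ℝ) : Prop :=
  ∀ (a : X → ℝ) (B : ℝ), (∀ x, |a x| ≤ B) →
    ∑ ω, (∑ x, (p ω x - p₀ x) * a x) ^ 2 ≤ Fintype.card Ω * (B ^ 2 * v)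

lemma le_sum_mul_of_le (hp : p ∈ stdSimplex ℝ X) {g : X → ℝ} {c : ℝ} (hg : ∀ x, c ≤ g x) :
    c ≤ ∑ x, p x * g x := by
  calc c = ∑ x, p x * c := by rw [← Finset.sum_mul, hp.2, one_mul]
    _ ≤ ∑ x, p x * g x :=
        Finset.sum_le_sum fun x _ => mul_le_mul_of_nonneg_left (hg x) (hp.1 x)

lemma MeanSquareVariationLE.sum_sub_one_sq_div_le {Ω : Type*} [Fintype Ω] {p₀ : X → ℝ}
    {p : Ω → X → ℝ} {v : ℝ} (hv : MeanSquareVariationLE p₀ p v) (hp₀ : p₀ ∈ stdSimplex ℝ X)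
    (hp : ∀ ω, p ω ∈ stdSimplex ℝ X) {C : ℝ} (hC : 1 ≤ C) {g : X → ℝ}
    (hg : ∀ x, g x ∈ Set.Icc C⁻¹ C) (hg1 : ∑ x, p₀ x * g x = 1) :
    ∑ ω, (∑ x, p ω x * g x - 1) ^ 2 / ∑ x, p ω x * g x
      ≤ C * (Fintype.card Ω * ((C - 1) ^ 2 * v)) := by
  have hC0 : 0 < C := by linarith
  have hdev : ∀ ω, ∑ x, p ω x * g x - 1 = ∑ x, (p ω x - p₀ x) * (g x - 1) := fun ω => by
    simp only [sub_mul, mul_sub, Finset.sum_sub_distrib, hg1, mul_one, (hp ω).2, hp₀.2]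
    ring
  have hgB : ∀ x, |g x - 1| ≤ C - 1 := fun x => by
    have hinv : 1 - C⁻¹ ≤ C - 1 :=
      (Real.one_sub_inv_le_log_of_pos hC0).trans (Real.log_le_sub_one_of_pos hC0)
    exact abs_le.2 ⟨by linarith [(hg x).1], by linarith [(hg x).2]⟩
  calc ∑ ω, (∑ x, p ω x * g x - 1) ^ 2 / ∑ x, p ω x * g x
      ≤ ∑ ω, C * (∑ x, (p ω x - p₀ x) * (g x - 1)) ^ 2 := by
        refine Finset.sum_le_sum fun ω _ => ?_
        have hr : C⁻¹ ≤ ∑ x, p ω x * g x := le_sum_mul_of_le (hp ω) fun x => (hg x).1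
        rw [hdev ω, div_eq_mul_inv, mul_comm]
        gcongr
        exact inv_le_of_inv_le₀ hC0 hr
    _ ≤ C * (Fintype.card Ω * ((C - 1) ^ 2 * v)) := by
        rw [← Finset.mul_sum]
        gcongr
        exact hv _ _ hgB

theorem sum_klDiv_mixture_le [∀ x, IsProbabilityMeasure (μ x)] {C : ℝ} (hC : 1 ≤ C)
    (hμ : ∀ x x', μ x ≤ ENNReal.ofReal C • μ x') {Ω : Type*} [Fintype Ω] {p₀ : X → ℝ}
    {p : Ω → X → ℝ} {v : ℝ} (hv : MeanSquareVariationLE p₀ p v) (hp₀ : p₀ ∈ stdSimplex ℝ X)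
    (hp : ∀ ω, p ω ∈ stdSimplex ℝ X) :
    ∑ ω, klDiv (mixture p₀ μ) (mixture (p ω) μ)
      ≤ ENNReal.ofReal (C * (Fintype.card Ω * ((C - 1) ^ 2 * v))) := by
  obtain ⟨g, hg, hgC, hmix⟩ := exists_mixture_density hp₀ hC hμ
  have hν : IsProbabilityMeasure (mixture p₀ μ) := isProbabilityMeasure_mixture hp₀
  set ν := mixture p₀ μ
  let r : Ω → E → ℝ := fun ω z => ∑ x, p ω x * g x z
  have hr0 : ∀ ω z, 0 < r ω z := fun ω z =>
    (by positivity : 0 < C⁻¹).trans_le (le_sum_mul_of_le (hp ω) fun x => (hgC x z).1)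
  have hone : ∀ᵐ z ∂ν, ∑ x, p₀ x * g x z = 1 := by
    have hd := (hmix p₀ hp₀.1).symm.trans withDensity_one.symm
    rw [withDensity_eq_iff_of_sigmaFinite (by fun_prop) (by fun_prop)] at hd
    filter_upwards [hd] with z hz
    exact ENNReal.ofReal_eq_one.1 hz
  calc ∑ ω, klDiv ν (mixture (p ω) μ)
      ≤ ∑ ω, ∫⁻ z, ENNReal.ofReal ((r ω z - 1) ^ 2 / r ω z) ∂ν := by
        refine Finset.sum_le_sum fun ω _ => ?_
        have := isProbabilityMeasure_mixture (μ := μ) (hp ω)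
        rw [hmix _ (hp ω).1] at this ⊢
        exact klDiv_withDensity_le_lintegral ν (by fun_prop) (hr0 ω)
    _ = ∫⁻ z, ENNReal.ofReal (∑ ω, (r ω z - 1) ^ 2 / r ω z) ∂ν := by
        simp_rw [ENNReal.ofReal_sum_of_nonneg fun ω _ => div_nonneg (sq_nonneg _) (hr0 ω _).le]
        exact (lintegral_finsetSum _ fun ω _ => by fun_prop).symm
    _ ≤ ∫⁻ _, ENNReal.ofReal (C * (Fintype.card Ω * ((C - 1) ^ 2 * v))) ∂ν := by
        refine lintegral_mono_ae ?_
        filter_upwards [hone] with z hz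
        exact ENNReal.ofReal_le_ofReal
          (hv.sum_sub_one_sq_div_le hp₀ hp hC (fun x => hgC x z) hz)
    _ = _ := by simp

end Mixture

section Release

variable {H X Z : Type*} [MeasurableSpace H] [MeasurableSpace X] [MeasurableSpace Z]

/-- The conditional law of the released variable given the history when the sensitive datum is
drawn from `ρ`, independently of the history. -/
noncomputable def release (Q : Kernel (H × X) Z) (ρ : Measure X) : Kernel H Z :=
  Q ∘ₖ (Kernel.id ×ₖ Kernel.const H ρ)

lemma isMarkovKernel_release (Q : Kernel (H × X) Z) [IsMarkovKernel Q] (ρ : Measure X)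
    [IsProbabilityMeasure ρ] : IsMarkovKernel (release Q ρ) := by
  unfold release; infer_instance

lemma release_apply (Q : Kernel (H × X) Z) (ρ : Measure X) [SFinite ρ] (y : H) {s : Set Z}
    (hs : MeasurableSet s) : release Q ρ y s = ∫⁻ x, Q (y, x) s ∂ρ := by
  rw [release, Kernel.comp_apply' _ _ _ hs, Kernel.lintegral_id_prod (Q.measurable_coe hs),
    Kernel.const_apply]

lemma map_compProd_prod_eq_compProd_release (ν : Measure H) [SFinite ν] (ρ : Measure X)
    [IsProbabilityMeasure ρ] (Q : Kernel (H × X) Z) [IsMarkovKernel Q] :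
    ((ν.prod ρ) ⊗ₘ Q).map (fun w => (w.1.1, w.2)) = ν ⊗ₘ release Q ρ := by
  have := isMarkovKernel_release Q ρ
  ext s hs
  have hpre : MeasurableSet ((fun w : (H × X) × Z => (w.1.1, w.2)) ⁻¹' s) :=
    hs.preimage (by fun_prop)
  rw [Measure.map_apply (by fun_prop) hs, Measure.compProd_apply hpre, Measure.compProd_apply hs,
    lintegral_prod _ (Kernel.measurable_kernel_prodMk_left hpre).aemeasurable]
  exact lintegral_congr fun y => (release_apply Q ρ y (measurable_prodMk_left hs)).symm

lemma compProd_release_mixture_dirac [Fintype X] (ν : Measure H) [SFinite ν] {p : X → ℝ}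
    (hp : p ∈ stdSimplex ℝ X) (Q : Kernel (H × X) Z) [IsMarkovKernel Q] :
    ν ⊗ₘ release Q (mixture p Measure.dirac) = mixture p fun x => ν ⊗ₘ Q.sectL x := by
  have := isProbabilityMeasure_mixture (μ := (Measure.dirac : X → Measure X)) hp
  have := isMarkovKernel_release Q (mixture p Measure.dirac)
  ext s hs
  have hdirac : ∀ y x, ∫⁻ x', Q (y, x') (Prod.mk y ⁻¹' s) ∂(Measure.dirac x)
      = Q.sectL x y (Prod.mk y ⁻¹' s) := fun y x => by
    have hm : Measurable fun x' => Q (y, x') (Prod.mk y ⁻¹' s) :=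
      (Q.measurable_coe (measurable_prodMk_left hs)).comp measurable_prodMk_left
    rw [lintegral_dirac' _ hm, Kernel.sectL_apply]
  have hsec : ∀ x, Measurable fun y => Q.sectL x y (Prod.mk y ⁻¹' s) :=
    fun x => Kernel.measurable_kernel_prodMk_left hs
  rw [Measure.compProd_apply hs]
  simp only [release_apply _ _ _ (measurable_prodMk_left hs), mixture, Measure.finsetSum_apply,
    Measure.smul_apply, Measure.compProd_apply hs, lintegral_finsetSum_measure,
    lintegral_smul_measure, hdirac, smul_eq_mul]
  rw [lintegral_finsetSum _ fun x _ => (hsec x).const_mul _]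
  exact Finset.sum_congr rfl fun x _ => lintegral_const_mul _ (hsec x)

lemma compProd_le_smul_compProd {C : ℝ≥0∞} (ν : Measure H) [SFinite ν] {κ η : Kernel H Z}
    [IsSFiniteKernel κ] [IsSFiniteKernel η] (h : ∀ y, κ y ≤ C • η y) : ν ⊗ₘ κ ≤ C • (ν ⊗ₘ η) := by
  refine Measure.le_iff.2 fun s hs => ?_
  rw [Measure.smul_apply, Measure.compProd_apply hs, Measure.compProd_apply hs, smul_eq_mul,
    ← lintegral_const_mul _ (Kernel.measurable_kernel_prodMk_left hs)]
  exact lintegral_mono fun y => h y _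

end Release
section Law

variable {K n : ℕ} {α : ℝ} (M : Mechanism.{u} K n α)

lemma isProbabilityMeasure_dataLaw {p : Fin K → ℝ} (hp : p ∈ stdSimplex ℝ (Fin K)) :
    IsProbabilityMeasure (dataLaw p) :=
  isProbabilityMeasure_mixture hp

lemma Mechanism.law_succ {p : Fin K → ℝ} (hp : p ∈ stdSimplex ℝ (Fin K)) (i : ℕ)
    [SFinite (M.law p i)] : M.law p (i + 1) = M.law p i ⊗ₘ release (M.Q i) (dataLaw p) :=
  have := isProbabilityMeasure_dataLaw hp
  map_compProd_prod_eq_compProd_release _ _ _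

lemma Mechanism.isProbabilityMeasure_law {p : Fin K → ℝ} (hp : p ∈ stdSimplex ℝ (Fin K)) (i : ℕ) :
    IsProbabilityMeasure (M.law p i) := by
  induction i with
  | zero => exact Measure.dirac.isProbabilityMeasure
  | succ i ih =>
    have := isProbabilityMeasure_dataLaw hp
    have := isMarkovKernel_release (M.Q i) (dataLaw p)
    rw [M.law_succ hp]
    exact inferInstanceAs (IsProbabilityMeasure (M.law p i ⊗ₘ release (M.Q i) (dataLaw p)))

lemma Mechanism.klDiv_law_succ {p q : Fin K → ℝ} (hp : p ∈ stdSimplex ℝ (Fin K))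
    (hq : q ∈ stdSimplex ℝ (Fin K)) (i : ℕ) :
    klDiv (M.law p (i + 1)) (M.law q (i + 1)) = klDiv (M.law p i) (M.law q i)
      + klDiv (mixture p fun x => M.law p i ⊗ₘ (M.Q i).sectL x)
        (mixture q fun x => M.law p i ⊗ₘ (M.Q i).sectL x) := by
  have := isProbabilityMeasure_dataLaw hp
  have := isProbabilityMeasure_dataLaw hq
  have := M.isProbabilityMeasure_law hp i
  have := M.isProbabilityMeasure_law hq i
  have := isMarkovKernel_release (M.Q i) (dataLaw p)
  have := isMarkovKernel_release (M.Q i) (dataLaw q)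
  rw [M.law_succ hp, M.law_succ hq, ← compProd_release_mixture_dirac _ hp,
    ← compProd_release_mixture_dirac _ hq]
  exact klDiv_compProd_eq_add (M.law p i) (M.law q i) (release (M.Q i) (dataLaw p))
    (release (M.Q i) (dataLaw q))

lemma Mechanism.compProd_sectL_le_smul {i : ℕ} (hi : i < n) (ν : Measure (Hist M.Z i)) [SFinite ν]
    (x x' : Fin K) :
    ν ⊗ₘ (M.Q i).sectL x ≤ ENNReal.ofReal (Real.exp α) • (ν ⊗ₘ (M.Q i).sectL x') :=
  compProd_le_smul_compProd ν fun h => Measure.le_iff.2 fun A hA => M.ldp i hi h x x' A hA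

theorem Mechanism.sum_klDiv_law_le (hα : 0 ≤ α) {Ω : Type*} [Fintype Ω] {p₀ : Fin K → ℝ}
    {p : Ω → Fin K → ℝ} {v : ℝ} (hv : MeanSquareVariationLE p₀ p v)
    (hp₀ : p₀ ∈ stdSimplex ℝ (Fin K)) (hp : ∀ ω, p ω ∈ stdSimplex ℝ (Fin K)) {i : ℕ}
    (hi : i ≤ n) :
    ∑ ω, klDiv (M.law p₀ i) (M.law (p ω) i) ≤ i * ENNReal.ofReal
      (Real.exp α * (Fintype.card Ω * ((Real.exp α - 1) ^ 2 * v))) := by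
  induction i with
  | zero =>
    exact (Finset.sum_eq_zero fun _ _ => klDiv_self (Measure.dirac PUnit.unit)).trans_le zero_le
  | succ i ih =>
    have := M.isProbabilityMeasure_law hp₀ i
    simp only [M.klDiv_law_succ hp₀ (hp _), Finset.sum_add_distrib, Nat.cast_add_one, add_mul,
      one_mul]
    exact add_le_add (ih (Nat.le_of_succ_le hi)) (sum_klDiv_mixture_le (Real.one_le_exp hα)
      (M.compProd_sectL_le_smul hi _) hv hp₀ hp)

end Law

section Minimax

lemma exp_mul_exp_sub_one_sq_le_privacyFactor {α : ℝ} (hα : 0 ≤ α) :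
    Real.exp α * (Real.exp α - 1) ^ 2 ≤ privacyFactor α := by
  have h1 : 1 ≤ Real.exp α := Real.one_le_exp hα
  have h2 : Real.exp (2 * α) = Real.exp α ^ 2 := by rw [← Real.exp_nat_mul]; norm_num
  have h3 : Real.exp (-2 * α) ≤ 1 := Real.exp_le_one_iff.2 (by linarith)
  calc Real.exp α * (Real.exp α - 1) ^ 2
      ≤ (Real.exp α + 1) ^ 2 * (Real.exp α - 1) ^ 2 := by gcongr; nlinarith
    _ = (Real.exp (2 * α) - 1) ^ 2 := by rw [h2]; ring
    _ ≤ privacyFactor α := by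
        unfold privacyFactor
        gcongr
        rw [h2, sub_nonneg]
        exact one_le_pow₀ h1

lemma MeanSquareVariationLE.nonneg {X Ω : Type*} [Fintype X] [Fintype Ω] [Nonempty Ω]
    {p₀ : X → ℝ} {p : Ω → X → ℝ} {v : ℝ} (hv : MeanSquareVariationLE p₀ p v) : 0 ≤ v := by
  have h := hv 0 1 (by simp)
  simp only [Pi.zero_apply, mul_zero, Finset.sum_const_zero, one_pow, one_mul, ne_eq,
    OfNat.ofNat_ne_zero, not_false_eq_true, zero_pow] at h
  exact nonneg_of_mul_nonneg_right h (by exact_mod_cast Fintype.card_pos)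

variable {K n : ℕ} {α γ : ℝ}

lemma Mechanism.ofReal_le_iSup_risk {M : Mechanism.{u} K n α} (F : M.Estimator) {p q : Fin K → ℝ}
    (hp : p ∈ stdSimplex ℝ (Fin K)) (hq : q ∈ stdSimplex ℝ (Fin K))
    (hpq : klDiv (M.law p n) (M.law q n) ≤ 2⁻¹) :
    ENNReal.ofReal ((powerSum γ p - powerSum γ q) ^ 2 / 16)
      ≤ ⨆ p ∈ stdSimplex ℝ (Fin K), M.risk F γ p := by
  have := M.isProbabilityMeasure_law hp n
  have := M.isProbabilityMeasure_law hq n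
  set R := ⨆ p ∈ stdSimplex ℝ (Fin K), M.risk F γ p
  have hR : ∀ r ∈ stdSimplex ℝ (Fin K), M.risk F γ r ≤ R :=
    fun r hr => le_iSup₂ (f := fun r _ => M.risk F γ r) r hr
  suffices h : 2 * ENNReal.ofReal ((powerSum γ p - powerSum γ q) ^ 2 / 16) ≤ 2 * R from
    (ENNReal.mul_le_mul_iff_right two_ne_zero ENNReal.ofNat_ne_top).1 h
  calc 2 * ENNReal.ofReal ((powerSum γ p - powerSum γ q) ^ 2 / 16)
      = ENNReal.ofReal ((powerSum γ p - powerSum γ q) ^ 2 / 8) := by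
        rw [← ENNReal.ofReal_ofNat 2, ← ENNReal.ofReal_mul two_pos.le]
        ring_nf
    _ ≤ M.risk F γ p + M.risk F γ q := ofReal_sq_sub_div_eight_le_lintegral_add hpq F.2 _ _
    _ ≤ 2 * R := (add_le_add (hR p hp) (hR q hq)).trans_eq (two_mul R).symm

variable {Ω : Type*} [Fintype Ω] [Nonempty Ω] {v Δ : ℝ}

lemma Mechanism.exists_klDiv_law_le_inv_two (M : Mechanism.{u} K n α) (hα : 0 ≤ α)
    {p₀ : Fin K → ℝ} (hp₀ : p₀ ∈ stdSimplex ℝ (Fin K)) {p : Ω → Fin K → ℝ}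
    (hp : ∀ ω, p ω ∈ stdSimplex ℝ (Fin K)) (hv : MeanSquareVariationLE p₀ p v)
    (hn : n * privacyFactor α * v ≤ 1 / 2) : ∃ ω, klDiv (M.law p₀ n) (M.law (p ω) n) ≤ 2⁻¹ := by
  have hle : n * (Real.exp α * (Fintype.card Ω * ((Real.exp α - 1) ^ 2 * v)))
      ≤ Fintype.card Ω * (1 / 2) := by
    have hα' := exp_mul_exp_sub_one_sq_le_privacyFactor hα
    have := hv.nonneg
    calc _ = Fintype.card Ω * (n * (Real.exp α * (Real.exp α - 1) ^ 2) * v) := by ring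
      _ ≤ Fintype.card Ω * (n * privacyFactor α * v) := by gcongr
      _ ≤ Fintype.card Ω * (1 / 2) := by gcongr
  obtain ⟨ω, -, hω⟩ := ENNReal.exists_le_of_sum_le Finset.univ_nonempty
    (f := fun ω => klDiv (M.law p₀ n) (M.law (p ω) n)) (g := fun _ : Ω => 2⁻¹) <| calc
      _ ≤ _ := M.sum_klDiv_law_le hα hv hp₀ hp le_rfl
      _ = ENNReal.ofReal (n * (Real.exp α * (Fintype.card Ω * ((Real.exp α - 1) ^ 2 * v)))) := by
        rw [ENNReal.ofReal_mul n.cast_nonneg, ENNReal.ofReal_natCast]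
      _ ≤ ENNReal.ofReal (Fintype.card Ω * (1 / 2)) := ENNReal.ofReal_le_ofReal hle
      _ = ∑ _ω : Ω, 2⁻¹ := by
        rw [ENNReal.ofReal_mul (Nat.cast_nonneg _), ENNReal.ofReal_natCast, one_div,
          ENNReal.ofReal_inv_of_pos two_pos, ENNReal.ofReal_ofNat, Finset.sum_const,
          Finset.card_univ, nsmul_eq_mul]
  exact ⟨ω, hω⟩

theorem MeanSquareVariationLE.ofReal_le_minimaxRisk (hα : 0 ≤ α) {p₀ : Fin K → ℝ}
    (hp₀ : p₀ ∈ stdSimplex ℝ (Fin K)) {p : Ω → Fin K → ℝ}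
    (hp : ∀ ω, p ω ∈ stdSimplex ℝ (Fin K)) (hv : MeanSquareVariationLE p₀ p v)
    (hn : n * privacyFactor α * v ≤ 1 / 2)
    (hΔ : ∀ ω, Δ ≤ (powerSum γ p₀ - powerSum γ (p ω)) ^ 2) :
    ENNReal.ofReal (Δ / 16) ≤ minimaxRisk.{u} γ K n α := by
  refine le_iInf fun M => le_iInf fun F => ?_
  obtain ⟨ω, hω⟩ := M.exists_klDiv_law_le_inv_two hα hp₀ hp hv hn
  exact (ENNReal.ofReal_le_ofReal (by gcongr; exact hΔ ω)).trans
    (Mechanism.ofReal_le_iSup_risk F hp₀ (hp ω) hω)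

end Minimax

section Extend

variable {ι X : Type*} [Fintype ι] [Fintype X] (e : ι ↪ X)

lemma sum_extend_zero {R : Type*} [AddCommMonoid R] {g : X → ℝ → R} (hg : ∀ x, g x 0 = 0)
    (q : ι → ℝ) : ∑ x, g x (Function.extend e q 0 x) = ∑ i, g (e i) (q i) := by
  refine (Finset.sum_of_injOn e e.injective.injOn (by simp) (fun x _ hx => ?_) fun i _ => ?_).symm
  · rw [Function.extend_apply' _ _ _ (by simpa using hx)]
    exact hg x
  · rw [e.injective.extend_apply]

lemma extend_zero_mem_stdSimplex {q : ι → ℝ} (hq : q ∈ stdSimplex ℝ ι) :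
    Function.extend e q 0 ∈ stdSimplex ℝ X := by
  refine ⟨fun x => ?_, (sum_extend_zero e (g := fun _ t => t) (fun _ => rfl) q).trans hq.2⟩
  by_cases h : ∃ i, e i = x
  · obtain ⟨i, rfl⟩ := h
    rw [e.injective.extend_apply]
    exact hq.1 i
  · rw [Function.extend_apply' _ _ _ h]
    exact le_rfl

lemma powerSum_extend_zero {K : ℕ} {γ : ℝ} (hγ : γ ≠ 0) (e : ι ↪ Fin K) (q : ι → ℝ) :
    powerSum γ (Function.extend e q 0) = ∑ i, q i ^ γ :=
  sum_extend_zero e (g := fun _ t => t ^ γ) (fun _ => Real.zero_rpow hγ) q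

variable {Ω : Type*} [Fintype Ω] {q₀ : ι → ℝ} {q : Ω → ι → ℝ} {v : ℝ}

lemma MeanSquareVariationLE.extend_zero (hv : MeanSquareVariationLE q₀ q v) :
    MeanSquareVariationLE (Function.extend e q₀ 0) (fun ω => Function.extend e (q ω) 0) v := by
  intro a B ha
  have hsum : ∀ ω, ∑ x, (Function.extend e (q ω) 0 x - Function.extend e q₀ 0 x) * a x
      = ∑ i, (q ω i - q₀ i) * a (e i) := fun ω => by
    simp only [sub_mul, Finset.sum_sub_distrib]
    rw [sum_extend_zero e (g := fun x t => t * a x) fun _ => zero_mul _,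
      sum_extend_zero e (g := fun x t => t * a x) fun _ => zero_mul _]
  simp only [hsum]
  exact hv _ B fun i => ha (e i)

theorem MeanSquareVariationLE.ofReal_le_minimaxRisk_of_card_le {K n : ℕ} {α γ Δ : ℝ} [Nonempty Ω]
    (hι : Fintype.card ι ≤ K) (hγ : γ ≠ 0) (hα : 0 ≤ α) (hq₀ : q₀ ∈ stdSimplex ℝ ι)
    (hq : ∀ ω, q ω ∈ stdSimplex ℝ ι) (hv : MeanSquareVariationLE q₀ q v)
    (hn : n * privacyFactor α * v ≤ 1 / 2)
    (hΔ : ∀ ω, Δ ≤ (∑ i, q₀ i ^ γ - ∑ i, q ω i ^ γ) ^ 2) :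
    ENNReal.ofReal (Δ / 16) ≤ minimaxRisk.{u} γ K n α := by
  obtain ⟨e⟩ : Nonempty (ι ↪ Fin K) := Function.Embedding.nonempty_of_card_le (by simpa using hι)
  refine (hv.extend_zero e).ofReal_le_minimaxRisk hα (extend_zero_mem_stdSimplex e hq₀)
    (fun ω => extend_zero_mem_stdSimplex e (hq ω)) hn fun ω => ?_
  rw [powerSum_extend_zero hγ, powerSum_extend_zero hγ]
  exact hΔ ω

end Extend

section Signs

variable {ι : Type*} [Fintype ι] [DecidableEq ι]

lemma sum_sign_mul_sign_eq_zero {i j : ι} (hij : i ≠ j) :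
    ∑ ε : ι → ℤˣ, ((ε i : ℤ) : ℝ) * ((ε j : ℤ) : ℝ) = 0 := by
  have hflip := Equiv.sum_comp (Equiv.mulRight (Pi.mulSingle i (-1 : ℤˣ)))
    fun ε : ι → ℤˣ => ((ε i : ℤ) : ℝ) * ((ε j : ℤ) : ℝ)
  simp only [Equiv.coe_mulRight, Pi.mul_apply, Pi.mulSingle_eq_same, Pi.mulSingle_eq_of_ne hij.symm,
    mul_neg, mul_one, Units.val_neg, Int.cast_neg, neg_mul, Finset.sum_neg_distrib] at hflip
  linarith

lemma sum_sq_sum_sign_mul (b : ι → ℝ) :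
    ∑ ε : ι → ℤˣ, (∑ i, ((ε i : ℤ) : ℝ) * b i) ^ 2
      = Fintype.card (ι → ℤˣ) * ∑ i, b i ^ 2 := by
  have hdiag : ∀ i, ∑ ε : ι → ℤˣ, ((ε i : ℤ) : ℝ) * ((ε i : ℤ) : ℝ)
      = Fintype.card (ι → ℤˣ) := fun i => by
    simp [← Int.cast_mul, Int.units_coe_mul_self]
  calc ∑ ε : ι → ℤˣ, (∑ i, ((ε i : ℤ) : ℝ) * b i) ^ 2
      = ∑ ε : ι → ℤˣ, ∑ i, ∑ j, (((ε i : ℤ) : ℝ) * ((ε j : ℤ) : ℝ)) * (b i * b j) := by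
        simp only [sq, Finset.sum_mul_sum, mul_mul_mul_comm]
    _ = ∑ i, ∑ j, (∑ ε : ι → ℤˣ, ((ε i : ℤ) : ℝ) * ((ε j : ℤ) : ℝ)) * (b i * b j) := by
        simp only [Finset.sum_mul]
        rw [Finset.sum_comm]
        exact Finset.sum_congr rfl fun i _ => Finset.sum_comm
    _ = ∑ i, Fintype.card (ι → ℤˣ) * (b i * b i) := Finset.sum_congr rfl fun i _ => by
        rw [Fintype.sum_eq_single i fun j hij => by
          rw [sum_sign_mul_sign_eq_zero hij.symm, zero_mul], hdiag]
    _ = Fintype.card (ι → ℤˣ) * ∑ i, b i ^ 2 := by simp only [← Finset.mul_sum, sq]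

end Signs

section Pairs

variable {J : Type*} [Fintype J]

/-- The weights of the pair construction: to each `j : J` correspond two cells, of masses
`(1 + s j) * δ` and `(1 - s j) * δ`, and the cell `none` carries the remaining mass. The null
hypothesis is `s = 0`; its perturbations move the mass of each pair to one cell, `s j = 1` or
`s j = -1`. -/
def pairWeights (δ : ℝ) (s : J → ℝ) : Option (J × Bool) → ℝ
  | none => 1 - 2 * Fintype.card J * δ
  | some (j, true) => (1 + s j) * δ
  | some (j, false) => (1 - s j) * δ

lemma sum_option_prod_bool {R : Type*} [AddCommMonoid R] (g : Option (J × Bool) → R) :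
    ∑ o, g o = g none + ∑ j, (g (some (j, true)) + g (some (j, false))) := by
  simp only [Fintype.sum_option, Fintype.sum_prod_type, Fintype.sum_bool]

lemma pairWeights_mem_stdSimplex {δ : ℝ} (hδ : 0 ≤ δ) (hJ : 2 * Fintype.card J * δ ≤ 1)
    {s : J → ℝ} (hs : ∀ j, |s j| ≤ 1) : pairWeights δ s ∈ stdSimplex ℝ (Option (J × Bool)) := by
  refine ⟨?_, ?_⟩
  · rintro (_ | ⟨j, _ | _⟩)
    · exact sub_nonneg.2 hJ
    · exact mul_nonneg (by linarith [(abs_le.1 (hs j)).2]) hδ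
    · exact mul_nonneg (by linarith [(abs_le.1 (hs j)).1]) hδ
  · simp only [sum_option_prod_bool, pairWeights, ← add_mul, add_add_sub_cancel, one_add_one_eq_two,
      Finset.sum_const, Finset.card_univ, nsmul_eq_mul]
    ring

lemma sum_pairWeights_sub_mul (δ : ℝ) (s : J → ℝ) (a : Option (J × Bool) → ℝ) :
    ∑ o, (pairWeights δ s o - pairWeights δ 0 o) * a o
      = ∑ j, s j * (δ * (a (some (j, true)) - a (some (j, false)))) := by
  simp only [sum_option_prod_bool, pairWeights, sub_self, zero_mul, zero_add, Pi.zero_apply]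
  exact Finset.sum_congr rfl fun j _ => by ring

lemma meanSquareVariationLE_pairWeights [DecidableEq J] (δ : ℝ) :
    MeanSquareVariationLE (pairWeights δ (0 : J → ℝ))
      (fun ε : J → ℤˣ => pairWeights δ fun j => ((ε j : ℤ) : ℝ))
      (4 * Fintype.card J * δ ^ 2) := by
  intro a B ha
  simp only [sum_pairWeights_sub_mul, sum_sq_sum_sign_mul]
  gcongr
  calc ∑ j, (δ * (a (some (j, true)) - a (some (j, false)))) ^ 2
      ≤ ∑ _j : J, δ ^ 2 * (2 * B) ^ 2 := Finset.sum_le_sum fun j _ => by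
        rw [mul_pow]
        gcongr ?_ * ?_
        refine sq_le_sq' ?_ ?_ <;>
          linarith [abs_le.1 (ha (some (j, true))), abs_le.1 (ha (some (j, false)))]
    _ = B ^ 2 * (4 * Fintype.card J * δ ^ 2) := by
        rw [Finset.sum_const, Finset.card_univ, nsmul_eq_mul]
        ring

lemma sum_pairWeights_zero_rpow_sub {γ δ : ℝ} (hγ : γ ≠ 0) (hδ : 0 ≤ δ) (ε : J → ℤˣ) :
    ∑ o, pairWeights δ (0 : J → ℝ) o ^ γ - ∑ o, pairWeights δ (fun j => ((ε j : ℤ) : ℝ)) o ^ γ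
      = Fintype.card J * (2 - 2 ^ γ) * δ ^ γ := by
  have hpair : ∀ j, ((1 + ((ε j : ℤ) : ℝ)) * δ) ^ γ + ((1 - ((ε j : ℤ) : ℝ)) * δ) ^ γ
      = 2 ^ γ * δ ^ γ := fun j => by
    rcases Int.units_eq_one_or (ε j) with h | h <;>
      simp [h, one_add_one_eq_two, Real.zero_rpow hγ, Real.mul_rpow two_pos.le hδ]
  simp only [sum_option_prod_bool, pairWeights, Pi.zero_apply, add_zero, sub_zero, one_mul, hpair,
    add_sub_add_left_eq_sub, Finset.sum_const, Finset.card_univ, nsmul_eq_mul]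
  ring

end Pairs

section TwoPoints

/-- The weights `(1 - δ, δ)` on two cells. -/
def twoPointWeights (δ : ℝ) : Bool → ℝ
  | false => 1 - δ
  | true => δ

lemma twoPointWeights_mem_stdSimplex {δ : ℝ} (hδ : δ ∈ Set.Icc (0 : ℝ) 1) :
    twoPointWeights δ ∈ stdSimplex ℝ Bool := by
  refine ⟨?_, by simp [twoPointWeights]⟩
  rintro (_ | _)
  exacts [sub_nonneg.2 hδ.2, hδ.1]

lemma meanSquareVariationLE_twoPointWeights (δ : ℝ) :
    MeanSquareVariationLE (twoPointWeights 0) (fun _ : Unit => twoPointWeights δ) (4 * δ ^ 2) := by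
  intro a B ha
  have hdiff : (a true - a false) ^ 2 ≤ (2 * B) ^ 2 := by
    refine sq_le_sq' ?_ ?_ <;> linarith [abs_le.1 (ha true), abs_le.1 (ha false)]
  simp only [Fintype.sum_unique, Fintype.sum_bool, twoPointWeights, Fintype.card_unit,
    Nat.cast_one, one_mul]
  calc _ = δ ^ 2 * (a true - a false) ^ 2 := by ring
    _ ≤ δ ^ 2 * (2 * B) ^ 2 := by gcongr
    _ = B ^ 2 * (4 * δ ^ 2) := by ring

lemma sum_twoPointWeights_zero_rpow_sub {γ : ℝ} (hγ : γ ≠ 0) (δ : ℝ) :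
    ∑ b, twoPointWeights 0 b ^ γ - ∑ b, twoPointWeights δ b ^ γ = 1 - (1 - δ) ^ γ - δ ^ γ := by
  simp only [Fintype.sum_bool, twoPointWeights, Real.zero_rpow hγ, sub_zero, Real.one_rpow]
  ring

end TwoPoints

section Gap

/-- A lower bound for the change of the power sum, per pair and in units of `δ ^ γ`, in both the
pair and the two-point construction. -/
noncomputable def gapConst (γ : ℝ) : ℝ := 1 - (1 / 2) ^ |1 - γ|

lemma gapConst_nonneg (γ : ℝ) : 0 ≤ gapConst γ :=
  sub_nonneg.2 (Real.rpow_le_one (by norm_num) (by norm_num) (abs_nonneg _))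

lemma gapConst_pos {γ : ℝ} (hγ : γ ≠ 1) : 0 < gapConst γ :=
  sub_pos.2 (Real.rpow_lt_one (by norm_num) (by norm_num) (abs_pos.2 (sub_ne_zero.2 hγ.symm)))

lemma gapConst_le_abs_two_sub_two_rpow (γ : ℝ) : gapConst γ ≤ |2 - 2 ^ γ| := by
  have hhalf : (1 / 2 : ℝ) ^ |1 - γ| = 2 ^ (-|1 - γ|) := by
    rw [one_div, Real.inv_rpow two_pos.le, Real.rpow_neg two_pos.le]
  have hnonneg := gapConst_nonneg γ
  rw [gapConst, hhalf] at hnonneg ⊢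
  rcases le_total γ 1 with h | h
  · rw [abs_of_nonneg (sub_nonneg.2 h), neg_sub] at hnonneg ⊢
    calc 1 - (2 : ℝ) ^ (γ - 1) ≤ 2 * (1 - 2 ^ (γ - 1)) := by linarith
      _ = 2 - 2 ^ γ := by rw [Real.rpow_sub_one two_ne_zero]; ring
      _ ≤ |2 - 2 ^ γ| := le_abs_self _
  · rw [abs_of_nonpos (sub_nonpos.2 h), neg_neg] at hnonneg ⊢
    calc 1 - (2 : ℝ) ^ (1 - γ) ≤ 2 ^ γ * (1 - 2 ^ (1 - γ)) :=
        le_mul_of_one_le_left hnonneg (Real.one_le_rpow one_le_two (by linarith))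
      _ = -(2 - 2 ^ γ) := by
        rw [mul_sub, ← Real.rpow_add two_pos, add_sub_cancel, Real.rpow_one]; ring
      _ ≤ |2 - 2 ^ γ| := neg_le_abs _

lemma gapConst_mul_rpow_le_abs {γ δ : ℝ} (hδ : 0 < δ) (hδ1 : δ ≤ 1 / 2) :
    gapConst γ * δ ^ γ ≤ |1 - (1 - δ) ^ γ - δ ^ γ| := by
  have hgap : gapConst γ ≤ 1 - δ ^ |1 - γ| :=
    sub_le_sub_left (Real.rpow_le_rpow hδ.le hδ1 (abs_nonneg _)) 1
  have h0 : 0 < 1 - δ := by linarith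
  rcases le_total γ 1 with h | h
  · rw [abs_of_nonneg (sub_nonneg.2 h)] at hgap
    have hle : 1 - δ ≤ (1 - δ) ^ γ := Real.self_le_rpow_of_le_one h0.le (by linarith) h
    calc gapConst γ * δ ^ γ ≤ (1 - δ ^ (1 - γ)) * δ ^ γ := by gcongr
      _ = δ ^ γ - δ := by
        rw [sub_mul, ← Real.rpow_add hδ, sub_add_cancel, Real.rpow_one, one_mul]
      _ ≤ -(1 - (1 - δ) ^ γ - δ ^ γ) := by linarith
      _ ≤ _ := neg_le_abs _
  · rw [abs_of_nonpos (sub_nonpos.2 h), neg_sub] at hgap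
    have hle : (1 - δ) ^ γ ≤ 1 - δ := Real.rpow_le_self_of_le_one h0.le (by linarith) h
    have hδγ : δ ^ γ ≤ δ := Real.rpow_le_self_of_le_one hδ.le (by linarith) h
    calc gapConst γ * δ ^ γ ≤ (1 - δ ^ (γ - 1)) * δ :=
        mul_le_mul hgap hδγ (by positivity) ((gapConst_nonneg γ).trans hgap)
      _ = δ - δ ^ γ := by rw [Real.rpow_sub_one hδ.ne']; field_simp
      _ ≤ 1 - (1 - δ) ^ γ - δ ^ γ := by linarith
      _ ≤ _ := le_abs_self _

end Gap

section Rate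

variable {K n : ℕ} {α γ : ℝ}

lemma ofReal_pairs_le_minimaxRisk {m : ℕ} {δ : ℝ} (hm : 2 * m < K) (hγ : γ ≠ 0) (hα : 0 ≤ α)
    (hδ : 0 ≤ δ) (hmδ : 2 * m * δ ≤ 1) (hn : n * privacyFactor α * (4 * m * δ ^ 2) ≤ 1 / 2) :
    ENNReal.ofReal ((m * gapConst γ * δ ^ γ) ^ 2 / 16) ≤ minimaxRisk.{u} γ K n α := by
  have hcard : Fintype.card (Option (Fin m × Bool)) ≤ K := by
    simp only [Fintype.card_option, Fintype.card_prod, Fintype.card_fin, Fintype.card_bool]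
    omega
  refine (meanSquareVariationLE_pairWeights (J := Fin m) δ).ofReal_le_minimaxRisk_of_card_le
    hcard hγ hα (pairWeights_mem_stdSimplex hδ (by simpa using hmδ) (by simp))
    (fun ε => pairWeights_mem_stdSimplex hδ (by simpa using hmδ) fun j => ?_) (by simpa using hn)
    fun ε => ?_
  · rcases Int.units_eq_one_or (ε j) with h | h <;> simp [h]
  · rw [sum_pairWeights_zero_rpow_sub hγ hδ, Fintype.card_fin]
    simp only [mul_pow]
    rw [← sq_abs (2 - _)]
    have := gapConst_nonneg γ
    gcongr
    exact gapConst_le_abs_two_sub_two_rpow γ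

lemma ofReal_twoPoints_le_minimaxRisk {δ : ℝ} (hK : 2 ≤ K) (hγ : γ ≠ 0) (hα : 0 ≤ α)
    (hδ : 0 < δ) (hδ1 : δ ≤ 1 / 2) (hn : n * privacyFactor α * (4 * δ ^ 2) ≤ 1 / 2) :
    ENNReal.ofReal ((gapConst γ * δ ^ γ) ^ 2 / 16) ≤ minimaxRisk.{u} γ K n α := by
  refine (meanSquareVariationLE_twoPointWeights δ).ofReal_le_minimaxRisk_of_card_le
    (by simpa using hK) hγ hα (twoPointWeights_mem_stdSimplex ⟨le_rfl, zero_le_one⟩)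
    (fun _ => twoPointWeights_mem_stdSimplex ⟨hδ.le, by linarith⟩) hn fun _ => ?_
  rw [sum_twoPointWeights_zero_rpow_sub hγ, ← sq_abs (1 - _ - _)]
  have := gapConst_nonneg γ
  gcongr
  exact gapConst_mul_rpow_le_abs hδ hδ1

lemma ofReal_cells_le_minimaxRisk {L δ : ℝ} (hL : 2 ≤ L) (hLK : L ≤ K) (hγ : γ ≠ 0)
    (hα : 0 ≤ α) (hδ : 0 < δ) (hLδ : 2 * L * δ ≤ 1)
    (hn : n * privacyFactor α * (2 * L * δ ^ 2) ≤ 1 / 2) :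
    ENNReal.ofReal ((L / 5 * gapConst γ * δ ^ γ) ^ 2 / 16) ≤ minimaxRisk.{u} γ K n α := by
  have hgap := gapConst_nonneg γ
  have hP : 0 ≤ privacyFactor α := sq_nonneg _
  have hK : 2 ≤ K := by exact_mod_cast hL.trans hLK
  rcases lt_or_ge L 3 with hL3 | hL3
  · refine le_trans (ENNReal.ofReal_le_ofReal ?_) (ofReal_twoPoints_le_minimaxRisk hK hγ hα hδ
      (by nlinarith) (hn.trans' ?_))
    · have : L / 5 * gapConst γ ≤ gapConst γ := mul_le_of_le_one_left hgap (by linarith)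
      gcongr
    · gcongr
      linarith
  · obtain ⟨m, hm⟩ : ∃ m, m = (⌊L⌋₊ - 1) / 2 := ⟨_, rfl⟩
    have hfloor : 3 ≤ ⌊L⌋₊ := Nat.le_floor (by exact_mod_cast hL3)
    have hfloorK : ⌊L⌋₊ ≤ K := Nat.floor_le_of_le hLK
    have hle : (2 * m : ℝ) ≤ L := le_trans (by exact_mod_cast (by omega : 2 * m ≤ ⌊L⌋₊))
      (Nat.floor_le (by linarith))
    have hge : L / 5 ≤ m := by
      have : (⌊L⌋₊ + 1 : ℝ) ≤ 5 * m := by exact_mod_cast (by omega : ⌊L⌋₊ + 1 ≤ 5 * m)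
      linarith [Nat.lt_floor_add_one L]
    refine le_trans (ENNReal.ofReal_le_ofReal (by gcongr)) (ofReal_pairs_le_minimaxRisk (m := m)
      (by omega) hγ hα hδ.le (hLδ.trans' ?_) (hn.trans' ?_))
    · gcongr
      linarith
    · have : (4 * m : ℝ) ≤ 2 * L := by linarith
      gcongr

/-- The constant of the lower bound on the minimax risk: `400 = 5² * 16`, where `L / 5` is the
number of pairs and `16` comes from the two-point bound, and `4 ^ γ` comes from the mass
`δ = (4 * L * T) ^ (-1 / 2)` of a cell. -/
noncomputable def riskConst (γ : ℝ) : ℝ := gapConst γ ^ 2 / (400 * 4 ^ γ)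

lemma riskConst_pos (hγ : γ ≠ 1) : 0 < riskConst γ := by
  have := gapConst_pos hγ
  unfold riskConst
  positivity

theorem ofReal_riskConst_mul_le_minimaxRisk {L : ℝ} (hL : 2 ≤ L) (hLK : L ≤ K) (hγ : γ ≠ 0)
    (hα : 0 ≤ α) :
    ENNReal.ofReal (riskConst γ * (L ^ (2 - γ) / max L (n * privacyFactor α) ^ γ))
      ≤ minimaxRisk.{u} γ K n α := by
  set N := n * privacyFactor α with hN
  set T := max L N
  have hL0 : 0 < L := by linarith
  have hT0 : 0 < T := lt_max_of_lt_left hL0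
  set δ := (2 * √(L * T))⁻¹
  have hδ0 : 0 < δ := by positivity
  have hδ2 : δ ^ 2 = (4 * (L * T))⁻¹ := by
    rw [inv_pow, mul_pow, Real.sq_sqrt (by positivity)]; norm_num
  have hδγ : (δ ^ γ) ^ 2 = (4 ^ γ * (L ^ γ * T ^ γ))⁻¹ := by
    rw [← Real.rpow_natCast, ← Real.rpow_mul hδ0.le, mul_comm, Real.rpow_mul hδ0.le,
      Real.rpow_natCast, hδ2, Real.inv_rpow (by positivity),
      Real.mul_rpow (by positivity) (by positivity), Real.mul_rpow hL0.le hT0.le]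
  refine le_trans (le_of_eq (congrArg _ ?_))
    (ofReal_cells_le_minimaxRisk (δ := δ) hL hLK hγ hα hδ0 ?_ ?_)
  · rw [mul_pow, mul_pow, hδγ, riskConst, Real.rpow_sub hL0, Real.rpow_two]
    field_simp
    ring
  · have : L ≤ √(L * T) := Real.le_sqrt_of_sq_le (by
      rw [sq]; gcongr; exact le_max_left _ _)
    rw [← div_eq_mul_inv, div_le_one (by positivity)]
    gcongr
  · rw [← hN, hδ2]
    calc N * (2 * L * (4 * (L * T))⁻¹) ≤ T * (2 * L * (4 * (L * T))⁻¹) := by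
          gcongr; exact le_max_right _ _
      _ = 1 / 2 := by field_simp; norm_num

lemma min_rpow_div_rpow_le_of_pos {k N : ℝ} (hk : 0 < k) (γ : ℝ) :
    min (k ^ (2 * (1 - γ))) (k ^ (2 - γ) / N ^ γ) ≤ k ^ (2 - γ) / max k N ^ γ := by
  rcases le_total k N with h | h
  · rw [max_eq_right h]
    exact min_le_right _ _
  · rw [max_eq_left h, ← Real.rpow_sub hk]
    exact (min_le_left _ _).trans_eq (by ring_nf)

lemma min_one_div_rpow_le_of_pos {k N : ℝ} (hN : 0 < N) (γ : ℝ) :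
    min (1 / N ^ (2 * (γ - 1))) (k ^ (2 - γ) / N ^ γ) ≤ min k N ^ (2 - γ) / N ^ γ := by
  rcases le_total k N with h | h
  · rw [min_eq_left h]
    exact min_le_right _ _
  · rw [min_eq_right h, ← Real.rpow_sub hN, one_div, ← Real.rpow_neg hN.le]
    exact (min_le_left _ _).trans_eq (by ring_nf)

lemma sixteen_mul_sq_le_privacyFactor (hα : 0 ≤ α) : 16 * α ^ 2 ≤ privacyFactor α := by
  have hsinh : 2 * α ≤ Real.sinh (2 * α) := Real.self_le_sinh_iff.2 (by linarith)
  rw [Real.sinh_eq, ← neg_mul] at hsinh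
  calc 16 * α ^ 2 = (4 * α) ^ 2 := by ring
    _ ≤ privacyFactor α := by unfold privacyFactor; gcongr; linarith

lemma two_le_privacyFactor_mul (hα : 0 ≤ α) (hn : 1 ≤ α ^ 2 * (n : ℝ)) :
    2 ≤ privacyFactor α * n := by
  have := mul_le_mul_of_nonneg_right (sixteen_mul_sq_le_privacyFactor hα) n.cast_nonneg
  linarith

end Rate

end LDP

theorem theorem5p2_general {γ : ℝ} (hγ0 : 0 < γ) (hγ1 : γ ≠ 1) :
    ∃ c : ℝ, 0 < c ∧ ∀ (K n : ℕ) (α : ℝ), 2 ≤ K → 0 < n → 0 < α →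
      ENNReal.ofReal (c * min ((K : ℝ) ^ (2 * (1 - γ)))
          ((K : ℝ) ^ (2 - γ) / ((n : ℝ) * LDP.privacyFactor α) ^ γ))
        ≤ LDP.minimaxRisk.{u} γ K n α ∧
      (1 ≤ α ^ 2 * (n : ℝ) →
        ENNReal.ofReal (c * min (1 / (LDP.privacyFactor α * (n : ℝ)) ^ (2 * (γ - 1)))
            ((K : ℝ) ^ (2 - γ) / (LDP.privacyFactor α * (n : ℝ)) ^ γ))
          ≤ LDP.minimaxRisk.{u} γ K n α) := by
  have hc := LDP.riskConst_pos hγ1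
  refine ⟨LDP.riskConst γ, hc, fun K n α hK _ hα => ⟨?_, fun hαn => ?_⟩⟩
  · have hK2 : (2 : ℝ) ≤ K := by exact_mod_cast hK
    refine le_trans (ENNReal.ofReal_le_ofReal ?_)
      (LDP.ofReal_riskConst_mul_le_minimaxRisk hK2 le_rfl hγ0.ne' hα.le)
    gcongr
    exact LDP.min_rpow_div_rpow_le_of_pos (by linarith) γ
  · have hN := LDP.two_le_privacyFactor_mul hα.le hαn
    have hL : 2 ≤ min (K : ℝ) (LDP.privacyFactor α * n) := le_min (by exact_mod_cast hK) hN
    refine le_trans (ENNReal.ofReal_le_ofReal ?_)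
      (LDP.ofReal_riskConst_mul_le_minimaxRisk hL (min_le_left _ _) hγ0.ne' hα.le)
    rw [mul_comm (n : ℝ), max_eq_right (min_le_right _ _)]
    gcongr
    exact LDP.min_one_div_rpow_le_of_pos (by linarith) γ

theorem theorem5p2 :
    (∀ γ : ℝ, 0 < γ → γ < 1 → ∃ c : ℝ, 0 < c ∧
      ∀ (K n : ℕ) (α : ℝ), 2 ≤ K → 0 < α → α < 1 → 1 ≤ α ^ 2 * (n : ℝ) →
        ENNReal.ofReal (c * min ((K : ℝ) ^ (2 * (1 - γ)))
            ((K : ℝ) ^ (2 - γ) / ((n : ℝ) * LDP.privacyFactor α) ^ γ))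
          ≤ LDP.minimaxRisk.{u} γ K n α) ∧
    (∀ γ : ℝ, 1 < γ → γ < 2 → ∃ c : ℝ, 0 < c ∧
      ∀ (K n : ℕ) (α : ℝ), 2 ≤ K → 0 < α → α < 1 → 1 ≤ α ^ 2 * (n : ℝ) →
        ENNReal.ofReal (c * min (1 / (LDP.privacyFactor α * (n : ℝ)) ^ (2 * (γ - 1)))
            ((K : ℝ) ^ (2 - γ) / (LDP.privacyFactor α * (n : ℝ)) ^ γ))
          ≤ LDP.minimaxRisk.{u} γ K n α) := by
  have hpos : ∀ {n : ℕ} {α : ℝ}, 1 ≤ α ^ 2 * (n : ℝ) → 0 < n := fun h =>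
    Nat.pos_of_ne_zero (by rintro rfl; norm_num at h)
  exact ⟨fun γ hγ hγ1 => (theorem5p2_general hγ hγ1.ne).imp fun c h => ⟨h.1,
      fun K n α hK hα _ hn => (h.2 K n α hK (hpos hn) hα).1⟩,
    fun γ hγ _ => (theorem5p2_general (one_pos.trans hγ) hγ.ne').imp fun c h => ⟨h.1,
      fun K n α hK hα _ hn => (h.2 K n α hK (hpos hn) hα).2 hn⟩⟩
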